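/- Let $a:[0,\infty)\to\mathbb R$ be continuous with $\Lambda_0^{-1}\le a(t)\le\Lambda_0$ for all $t\ge 0$ and some $\Lambda_0\ge 1$, and let $\varphi\ge 0$ be a function in $L^1(0,\infty)$. Let $\mu:[0,\infty)\to[0,\infty)$ be a modulus of continuity, that is, $\mu$ is continuous, increasing (in the wide sense), concave, $\mu(0)=0$ and $\mu(s)>0$ for $s>0$, and suppose that $\mu$ satisfies the Osgood condition $\int_0^1\frac{ds}{\mu(s)}=+\infty$. Suppose that there is a function $\psi\ge0$ in $L^1(0,\infty)\cap L^\infty(0,\infty)$ such that $$\sup_{\max\{0,\,t-\frac12\}<t_1<t_2<t+\frac12}\frac{|a(t_2)-a(t_1)|}{\mu(t_2-t_1)}\le\psi(t)\qquad\text{for a.e. }t>0.$$ Let $u=u(t,x)$ be a complex-valued function on $(0,\infty)\times\mathbb R$ with $$u\in L^2_{\rm loc}\big((0,\infty);H^2(\mathbb R_x)\big)\cap H^1_{\rm loc}\big((0,\infty);L^2(\mathbb R_x)\big),$$ such that $$\|u_t(t,\cdot)-a(t)u_{xx}(t,\cdot)\|_{L^2(\mathbb R_x)}^2\le\varphi(t)\,\|u(t,\cdot)\|_{H^1(\mathbb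 R_x)}^2\qquad\text{for a.e. }t>0,$$ where $\|v\|_{H^1}^2=\|v\|_{L^2}^2+\|v_x\|_{L^2}^2$, and such that for every $\lambda>0$ $$\lim_{t\to+\infty}e^{\lambda t}\|u(t,\cdot)\|_{H^1(\mathbb R_x)}=0 .$$ (The limit may be understood as an essential limit, that is, up to null sets of times $t$.) Then $u\equiv0$, that is, $u(t,\cdot)=0$ in $L^2(\mathbb R)$ for a.e. $t>0$. -/

import Mathlib

open MeasureTheory Set Filter Topology
open scoped ENNReal ContDiff SchwartzMap

/-- `L²(ℝ)`, with complex values. -/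
abbrev L2R : Type := Lp ℂ 2 (volume : Measure ℝ)

/-- `μ` is a modulus of continuity: a continuous, increasing, concave function on `[0, ∞)` with
`μ 0 = 0`, positive on `(0, ∞)`. ("Increasing" is read in the wide sense.) -/
structure IsModulusOfContinuity (μ : ℝ → ℝ) : Prop where
  continuousOn : ContinuousOn μ (Ici 0)
  monotoneOn : MonotoneOn μ (Ici 0)
  concaveOn : ConcaveOn ℝ (Ici 0) μ
  map_zero : μ 0 = 0
  pos : ∀ s, 0 < s → 0 < μ s

/-- The Osgood condition `∫₀¹ ds / μ(s) = +∞`. -/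
def OsgoodCondition (μ : ℝ → ℝ) : Prop :=
  ∫⁻ s in Ioc (0 : ℝ) 1, ENNReal.ofReal (1 / μ s) = ⊤

/-- `w` is locally square integrable on `(0, ∞)` (strong measurability included):
`w ∈ L²_loc((0, ∞); E)`. -/
def MemL2Loc {E : Type*} [NormedAddCommGroup E] (w : ℝ → E) : Prop :=
  ∀ s T : ℝ, 0 < s → MemLp w 2 (volume.restrict (Icc s T))

/-- `g ∈ L²(ℝ)` is the distributional derivative of `f ∈ L²(ℝ)`. -/
def IsWeakDerivX (f g : L2R) : Prop :=
  LineDeriv.lineDerivOp (1 : ℝ) (f : 𝓢'(ℝ, ℂ)) = (g : 𝓢'(ℝ, ℂ))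

/-- `v` is the weak derivative in time, on `(0, ∞)`, of the `L²(ℝ)`-valued function `u`. -/
def IsWeakDerivT (u v : ℝ → L2R) : Prop :=
  ∀ η : ℝ → ℝ, ContDiff ℝ ∞ η → HasCompactSupport η → tsupport η ⊆ Ioi 0 →
    ∫ t in Ioi (0 : ℝ), deriv η t • u t = - ∫ t in Ioi (0 : ℝ), η t • v t

/-- `u ∈ L²_loc((0, ∞); H²(ℝ))`, with first and second space derivatives `ux`, `uxx`. -/
structure MemL2LocH2 (u ux uxx : ℝ → L2R) : Prop where
  memL2Loc : MemL2Loc u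
  memL2Loc_dx : MemL2Loc ux
  memL2Loc_dxx : MemL2Loc uxx
  weakDeriv_dx : ∀ᵐ t ∂(volume.restrict (Ioi (0 : ℝ))), IsWeakDerivX (u t) (ux t)
  weakDeriv_dxx : ∀ᵐ t ∂(volume.restrict (Ioi (0 : ℝ))), IsWeakDerivX (ux t) (uxx t)

/-- `u ∈ H¹_loc((0, ∞); L²(ℝ))`, with time derivative `ut`. -/
structure MemH1LocL2 (u ut : ℝ → L2R) : Prop where
  memL2Loc : MemL2Loc u
  memL2Loc_dt : MemL2Loc ut
  weakDeriv_dt : IsWeakDerivT u ut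

/-- The `H¹(ℝ)` norm of a function, in terms of the function `f` and its derivative `fx`. -/
noncomputable def normH1 (f fx : L2R) : ℝ := Real.sqrt (‖f‖ ^ 2 + ‖fx‖ ^ 2)

/-- `u` lies in `L²_loc(H²) ∩ H¹_loc(L²)`, satisfies
`‖u_t - a(t) u_xx‖²_{L²} ≤ φ(t) ‖u‖²_{H¹}` for a.e. `t > 0`, and
`e^{λ t} ‖u(t)‖_{H¹} → 0` as `t → +∞` for every `λ > 0`.
Since `u` is given up to null sets of times, the limit is the essential one; it is the
ordinary limit for the representative of `u` that is continuous with values in `H¹(ℝ)`. -/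
def IsRapidlyDecayingSolution (a φ : ℝ → ℝ) (u : ℝ → L2R) : Prop :=
  ∃ ut ux uxx : ℝ → L2R,
    MemL2LocH2 u ux uxx ∧ MemH1LocL2 u ut ∧
    (∀ᵐ t ∂(volume.restrict (Ioi (0 : ℝ))),
      ‖ut t - a t • uxx t‖ ^ 2 ≤ φ t * normH1 (u t) (ux t) ^ 2) ∧
    ∀ l : ℝ, 0 < l →
      Tendsto (fun t => Real.exp (l * t) * normH1 (u t) (ux t)) (atTop ⊓ ae volume) (𝓝 0)

/-!
The coefficient `a` depends on time only, so the operators `a(t) ∂ₓ²` are multiples of a fixed one,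
and `a` does not enter the frequency function `N = ‖u_x‖² / ‖u‖²`, which can therefore be
differentiated without differentiating `a`. Write `H = ‖u‖²`, `D = ‖u_x‖²` and
`f = u_t - a u_xx`, so that
`‖f‖² ≤ φ (H + D)`. Then `H' = 2 ⟪u, u_t⟫` and `D' = -2 ⟪u_xx, u_t⟫`. Let `z = u_xx + N u`, which is
orthogonal to `u`; a computation gives
`N' = (-2 a ‖z‖² - 2 ⟪z, f⟫) / H ≤ ‖f‖² / (2 a H) ≤ (Λ₀ / 2) φ (1 + N)`
(`frequency_deriv_numerator_le`). As `φ` is integrable, `log (1 + N)`, and hence `N`, is bounded as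
long as `H > 0`. Consequently `(log H)' = -2 a N + 2 ⟪u, f⟫ / H` is at least a constant minus a
multiple of `φ` (`neg_le_energy_deriv`), and `H (t) ≥ k exp (-C (t - s))` for all `t ≥ s` once
`H (s) > 0`; in particular `H` cannot vanish in finite time (`exists_exp_le_of_frequency_bound`).
This contradicts decay faster than every exponential, unless `H` vanishes identically.

With the regularity at hand, `H` and `D` have to be shown to be absolutely continuous. For `H`, the
du Bois-Reymond lemma shows that `u` is a.e. a primitive of `u_t`
(`ae_eq_add_primitive_of_weakDeriv`). For `D`, the derivative `∂ₓ` is replaced by bounded operators,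
truncations of the Fourier multiplier `2πiξ` (`exists_bounded_approx_deriv`), for which the energy
identity is the chain rule; the truncation is then removed by dominated convergence
(`exists_primitive_normSq_of_approx`).
-/

/-! ### The weak space derivative on the Fourier side -/

open FourierTransform in
/-- The Fourier transform turns the weak derivative into multiplication by `2πiξ`. -/
theorem IsWeakDerivX.fourier_ae_eq {f g : L2R} (h : IsWeakDerivX f g) :
    (𝓕 g : L2R) =ᵐ[volume] fun ξ => (2 * Real.pi * Complex.I * ξ) * (𝓕 f : L2R) ξ := by
  have key : ∀ u : 𝓢(ℝ, ℂ), ∫ ξ, u ξ • (𝓕 g : L2R) ξ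
      = ∫ ξ, u ξ • ((2 * Real.pi * Complex.I * ξ) * (𝓕 f : L2R) ξ) := by
    intro u
    have h1 : 𝓕 (g : 𝓢'(ℝ, ℂ)) = (2 * Real.pi * Complex.I) •
        TemperedDistribution.smulLeftCLM ℂ (fun x : ℝ => ((inner ℝ x (1 : ℝ) : ℝ) : ℂ))
          (𝓕 (f : 𝓢'(ℝ, ℂ))) := by
      rw [← TemperedDistribution.fourier_lineDerivOp_eq, h]
    rw [Lp.fourier_toTemperedDistribution_eq, Lp.fourier_toTemperedDistribution_eq] at h1
    have h2 := congrArg (fun T : 𝓢'(ℝ, ℂ) => T u) h1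
    have hg : (fun x : ℝ => ((inner ℝ x (1 : ℝ) : ℝ) : ℂ)).HasTemperateGrowth := by fun_prop
    simp only [Lp.toTemperedDistribution_apply, smul_apply,
      TemperedDistribution.smulLeftCLM_apply_apply] at h2
    rw [h2, ← integral_smul]
    congr 1
    ext ξ
    rw [SchwartzMap.smulLeftCLM_apply_apply hg]
    simp
    ring
  have hli : ∀ w : L2R, LocallyIntegrable w volume := fun w =>
    (Lp.memLp w).locallyIntegrable (by norm_num)
  have hc : Continuous fun ξ : ℝ => (2 * Real.pi * Complex.I * ξ : ℂ) := by fun_prop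
  have hlf : LocallyIntegrable
      (fun ξ : ℝ => (2 * Real.pi * Complex.I * ξ) * (𝓕 f : L2R) ξ) volume :=
    (hli (𝓕 f : L2R)).continuous_smul hc
  refine ae_eq_of_integral_contDiff_smul_eq (hli _) hlf ?_
  intro η hη hηc
  have hη' : ContDiff ℝ ∞ (fun x => (η x : ℂ)) := Complex.ofRealCLM.contDiff.comp hη
  have hηc' : HasCompactSupport (fun x => (η x : ℂ)) :=
    hηc.comp_left (g := Complex.ofReal) Complex.ofReal_zero
  exact key (hηc'.toSchwartzMap hη')

/-- Multiplication of `L²(ℝ)` functions by a bounded measurable function. -/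
noncomputable def mulL2 (m : ℝ → ℂ) (hm : MemLp m ∞ volume) : L2R →L[ℂ] L2R :=
  (ContinuousLinearMap.mul ℂ ℂ).holderL volume ∞ 2 2 (hm.toLp m)

theorem mulL2_ae_eq (m : ℝ → ℂ) (hm : MemLp m ∞ volume) (f : L2R) :
    mulL2 m hm f =ᵐ[volume] fun ξ => m ξ * f ξ := by
  have h := ContinuousLinearMap.coeFn_holder (B := ContinuousLinearMap.mul ℂ ℂ) (r := 2)
    (hm.toLp m) f
  filter_upwards [h, hm.coeFn_toLp] with ξ h1 h2
  have : mulL2 m hm f ξ = _ := h1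
  rw [this, h2]; rfl

theorem norm_mulL2_le (m : ℝ → ℂ) (hm : MemLp m ∞ volume) (h1 : ∀ ξ, ‖m ξ‖ ≤ 1) (f : L2R) :
    ‖mulL2 m hm f‖ ≤ ‖f‖ := by
  refine Lp.norm_le_norm_of_ae_le ?_
  filter_upwards [mulL2_ae_eq m hm f] with ξ h
  rw [h, norm_mul]
  exact mul_le_of_le_one_left (norm_nonneg _) (h1 ξ)

/-- The indicator function of the frequency band `|ξ| ≤ n`. -/
noncomputable def band (n : ℕ) : ℝ → ℂ := (Icc (-(n : ℝ)) n).indicator 1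

theorem norm_band_le (n : ℕ) (ξ : ℝ) : ‖band n ξ‖ ≤ 1 := by
  unfold band
  by_cases h : ξ ∈ Icc (-(n : ℝ)) n <;> simp [h]

theorem memLp_band (n : ℕ) : MemLp (band n) ∞ volume :=
  memLp_top_of_bound ((measurable_one.indicator measurableSet_Icc).aestronglyMeasurable) 1
    (Eventually.of_forall (norm_band_le n))

theorem memLp_band_mul (n : ℕ) :
    MemLp (fun ξ : ℝ => band n ξ * (2 * Real.pi * Complex.I * ξ)) ∞ volume := by
  have hm : Measurable (band n) := measurable_one.indicator measurableSet_Icc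
  refine memLp_top_of_bound (hm.mul (by fun_prop)).aestronglyMeasurable (2 * Real.pi * n)
    (Eventually.of_forall fun ξ => ?_)
  unfold band
  by_cases h : ξ ∈ Icc (-(n : ℝ)) n
  · have : |ξ| ≤ n := abs_le.2 h
    simp only [h, indicator_of_mem, Pi.one_apply, one_mul, norm_mul, Complex.norm_I,
      Complex.norm_real, Real.norm_eq_abs, abs_of_pos Real.pi_pos, RCLike.norm_ofNat, mul_one]
    gcongr
  · simp only [h, not_false_eq_true, indicator_of_notMem, zero_mul, norm_zero]
    positivity

theorem tendsto_mulL2_band (f : L2R) :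
    Tendsto (fun n => mulL2 (band n) (memLp_band n) f) atTop (𝓝 f) := by
  rw [tendsto_iff_norm_sub_tendsto_zero]
  have hsq : Tendsto (fun n => ‖mulL2 (band n) (memLp_band n) f - f‖ ^ 2) atTop (𝓝 0) := by
    have h1 : ∀ n, ‖mulL2 (band n) (memLp_band n) f - f‖ ^ 2
        = ∫ ξ, ‖band n ξ * f ξ - f ξ‖ ^ 2 := by
      intro n
      rw [← real_inner_self_eq_norm_sq, L2.inner_def]
      refine integral_congr_ae ?_
      filter_upwards [mulL2_ae_eq (band n) (memLp_band n) f,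
        Lp.coeFn_sub (mulL2 (band n) (memLp_band n) f) f] with ξ h2 h3
      rw [h3, Pi.sub_apply, h2, real_inner_self_eq_norm_sq]
    simp_rw [h1]
    have hm : ∀ n, Measurable (band n) := fun n => measurable_one.indicator measurableSet_Icc
    have h0 : ∫ _ : ℝ, (0 : ℝ) = 0 := by simp
    rw [← h0]
    refine tendsto_integral_of_dominated_convergence (fun ξ => 4 * ‖f ξ‖ ^ 2) ?_ ?_ ?_ ?_
    · intro n
      have := Lp.aestronglyMeasurable f
      have h2 := (hm n).aestronglyMeasurable (μ := (volume : Measure ℝ))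
      exact ((h2.mul this).sub this).norm.pow 2
    · exact ((memLp_two_iff_integrable_sq_norm (Lp.aestronglyMeasurable f)).1
        (Lp.memLp f)).const_mul 4
    · intro n
      refine Eventually.of_forall fun ξ => ?_
      have h2 : ‖band n ξ * f ξ - f ξ‖ ≤ 2 * ‖f ξ‖ := by
        calc _ ≤ ‖band n ξ * f ξ‖ + ‖f ξ‖ := norm_sub_le _ _
          _ ≤ 1 * ‖f ξ‖ + ‖f ξ‖ := by
            rw [norm_mul]; gcongr; exact norm_band_le n ξ
          _ = 2 * ‖f ξ‖ := by ring
      rw [Real.norm_of_nonneg (by positivity)]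
      calc _ ≤ (2 * ‖f ξ‖) ^ 2 := by gcongr
        _ = _ := by ring
    · refine Eventually.of_forall fun ξ => ?_
      obtain ⟨N, hN⟩ := exists_nat_ge |ξ|
      refine tendsto_const_nhds.congr' ?_
      filter_upwards [eventually_ge_atTop N] with n hn
      have : ξ ∈ Icc (-(n : ℝ)) n := abs_le.1 (hN.trans (by exact_mod_cast hn))
      simp [band, this]
  have := hsq.sqrt
  simpa [Real.sqrt_sq] using this

open FourierTransform in
/-- Bounded approximations of `d/dx`. The operator `Q n` is the Fourier transform followed by
multiplication by `2πiξ 1_{|ξ| ≤ n}`, and `S n` is the projection onto the frequencies `|ξ| ≤ n`;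
the last property is integration by parts, `S n k` being the truncation of `k = f''`. -/
theorem exists_bounded_approx_deriv :
    ∃ Q S : ℕ → L2R →L[ℝ] L2R, (∀ n f, ‖S n f‖ ≤ ‖f‖) ∧
      (∀ f, Tendsto (fun n => S n f) atTop (𝓝 f)) ∧
      (∀ f g, IsWeakDerivX f g → Tendsto (fun n => ‖Q n f‖) atTop (𝓝 ‖g‖)) ∧
      ∀ f g k, IsWeakDerivX f g → IsWeakDerivX g k → ∀ n w,
        inner ℝ (Q n f) (Q n w) = - inner ℝ (S n k) w := by
  let F := Lp.fourierTransformₗᵢ ℝ ℂ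
  let M : ℕ → L2R →L[ℂ] L2R := fun n => mulL2 (band n) (memLp_band n)
  let B : ℕ → L2R →L[ℂ] L2R := fun n => mulL2 _ (memLp_band_mul n)
  -- the real inner product is determined by the norm, which `F` preserves
  have hFi : ∀ f g : L2R, inner ℝ (F f) (F g) = inner ℝ f g := fun f g => by
    rw [real_inner_eq_norm_add_mul_self_sub_norm_mul_self_sub_norm_mul_self_div_two,
      real_inner_eq_norm_add_mul_self_sub_norm_mul_self_sub_norm_mul_self_div_two,
      ← map_add, F.norm_map, F.norm_map, F.norm_map]
  refine ⟨fun n => ((B n).comp (F : L2R →L[ℂ] L2R)).restrictScalars ℝ,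
    fun n => ((F.symm : L2R →L[ℂ] L2R).comp ((M n).comp (F : L2R →L[ℂ] L2R))).restrictScalars ℝ,
    ?_, ?_, ?_, ?_⟩
  · intro n f
    change ‖F.symm (M n (F f))‖ ≤ _
    rw [F.symm.norm_map, ← F.norm_map f]
    exact norm_mulL2_le _ _ (norm_band_le n) _
  · intro f
    change Tendsto (fun n => F.symm (M n (F f))) atTop _
    have := (F.symm.continuous.tendsto (F f)).comp (tendsto_mulL2_band (F f))
    rwa [F.symm_apply_apply] at this
  · intro f g hfg
    change Tendsto (fun n => ‖B n (F f)‖) atTop _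
    have h1 : ∀ n, B n (F f) = M n (F g) := by
      intro n
      refine Lp.ext ?_
      filter_upwards [mulL2_ae_eq _ (memLp_band_mul n) (F f), mulL2_ae_eq _ (memLp_band n) (F g),
        hfg.fourier_ae_eq] with ξ h2 h3 h4
      have h4' : F g ξ = _ := h4
      rw [h2, h3, h4', mul_assoc]
      rfl
    simp_rw [h1, ← F.norm_map g]
    exact (tendsto_mulL2_band (F g)).norm
  · intro f g k hfg hgk n w
    change inner ℝ (B n (F f)) (B n (F w)) = - inner ℝ (F.symm (M n (F k))) w
    rw [← hFi (F.symm _), F.apply_symm_apply, L2.inner_def, L2.inner_def, ← integral_neg]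
    refine integral_congr_ae ?_
    filter_upwards [mulL2_ae_eq _ (memLp_band_mul n) (F f), mulL2_ae_eq _ (memLp_band_mul n) (F w),
      mulL2_ae_eq _ (memLp_band n) (F k), hfg.fourier_ae_eq, hgk.fourier_ae_eq]
      with ξ h1 h2 h3 h4 h5
    have h4' : F g ξ = _ := h4
    have h5' : F k ξ = _ := h5
    have h6 : F k ξ = (2 * Real.pi * Complex.I * ξ) * ((2 * Real.pi * Complex.I * ξ) * F f ξ) := by
      rw [h5']; congr 1
    rw [h1, h2, h3, h6]
    unfold band
    by_cases h : ξ ∈ Icc (-(n : ℝ)) n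
    · simp [h, Complex.inner]
      ring
    · simp [h]

/-! ### Absolute continuity and weak derivatives in time -/

theorem AbsolutelyContinuousOnInterval.of_dist_le {X Y : Type*} [PseudoMetricSpace X]
    [PseudoMetricSpace Y] {f : ℝ → X} {g : ℝ → Y} {a b : ℝ}
    (hg : AbsolutelyContinuousOnInterval g a b)
    {K : ℝ} (h : ∀ x ∈ uIcc a b, ∀ y ∈ uIcc a b, dist (f x) (f y) ≤ K * dist (g x) (g y)) :
    AbsolutelyContinuousOnInterval f a b := by
  have hg' := Tendsto.const_mul K hg
  rw [mul_zero] at hg'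
  refine squeeze_zero' (Eventually.of_forall fun _ => Finset.sum_nonneg fun _ _ => dist_nonneg)
    ?_ hg'
  rw [eventually_inf_principal]
  refine Eventually.of_forall fun E hE => ?_
  rw [Finset.mul_sum]
  exact Finset.sum_le_sum fun i hi => h _ (hE.1 i hi).1 _ (hE.1 i hi).2

theorem MeasureTheory.LocallyIntegrable.intervalIntegrable {E : Type*} [NormedAddCommGroup E]
    {v : ℝ → E}
    (hv : LocallyIntegrable v) (a b : ℝ) : IntervalIntegrable v volume a b :=
  intervalIntegrable_iff.2
    ((hv.integrableOn_isCompact isCompact_uIcc).mono_set uIoc_subset_uIcc)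

section

variable {E : Type*} [NormedAddCommGroup E] [NormedSpace ℝ E]

theorem MeasureTheory.LocallyIntegrable.absolutelyContinuousOnInterval {v : ℝ → E}
    (hv : LocallyIntegrable v) (a b c : ℝ) :
    AbsolutelyContinuousOnInterval (fun t => ∫ s in c..t, v s) a b := by
  have hi := hv.intervalIntegrable
  have h1 := ((hi a b).norm.absolutelyContinuousOnInterval_intervalIntegral (c := a) (by simp))
  refine h1.of_dist_le (K := 1) fun x _ y _ => ?_
  rw [one_mul, dist_comm, dist_eq_norm,
    intervalIntegral.integral_interval_sub_left (hi _ _) (hi _ _), dist_comm, Real.dist_eq,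
    intervalIntegral.integral_interval_sub_left (hi _ _).norm (hi _ _).norm]
  exact intervalIntegral.norm_integral_le_abs_integral_norm

variable [CompleteSpace E]

/-- Integration by parts of a primitive against a test function. -/
theorem integral_deriv_smul_primitive {v : ℝ → E} (hv : LocallyIntegrable v) (c : ℝ)
    {η : ℝ → ℝ} (hη : ContDiff ℝ ∞ η) (hηc : HasCompactSupport η) :
    ∫ t, deriv η t • ∫ s in c..t, v s = - ∫ t, η t • v t := by
  set V : ℝ → E := fun t => ∫ s in c..t, v s with hV
  have hVc : Continuous V := intervalIntegral.continuous_primitive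
    (hv.intervalIntegrable) c
  have hη' : Continuous (deriv η) := hη.continuous_deriv (by simp)
  have hi1 : Integrable (fun t => deriv η t • V t) :=
    (hη'.smul hVc).integrable_of_hasCompactSupport hηc.deriv.smul_right
  have hi2 : Integrable (fun t => η t • v t) :=
    hv.integrable_smul_left_of_hasCompactSupport hη.continuous hηc
  obtain ⟨R, hR⟩ := hηc.isCompact.isBounded.subset_closedBall 0
  have hsupp : ∀ t, R < |t| → η t = 0 := by
    intro t ht
    refine image_eq_zero_of_notMem_tsupport fun h => ?_
    have := hR h
    rw [mem_closedBall_zero_iff, Real.norm_eq_abs] at this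
    linarith
  set r := |R| + 1 with hr
  have hRr : R < r := by have := le_abs_self R; linarith
  have hr0 : 0 < r := by positivity
  have hsum : ∫ t, (deriv η t • V t + η t • v t) = 0 := by
    have hss : Function.support (fun t => deriv η t • V t + η t • v t) ⊆ Ioc (-r) r := by
      intro t ht
      have : t ∈ tsupport η := by
        by_contra hn
        apply ht
        have h1 : deriv η t = 0 := by
          have : t ∉ tsupport (deriv η) := fun h => hn (tsupport_deriv_subset (𝕜 := ℝ) h)
          exact image_eq_zero_of_notMem_tsupport this
        simp [h1, image_eq_zero_of_notMem_tsupport hn]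
      have := hR this
      rw [mem_closedBall_zero_iff, Real.norm_eq_abs] at this
      have := abs_le.1 this
      constructor <;> linarith
    rw [← intervalIntegral.integral_eq_integral_of_support_subset hss]
    -- `η V` minus the primitive of its a.e. derivative is absolutely continuous with derivative
    -- zero a.e., hence constant; and `η` vanishes at both ends of `[-r, r]`
    have hac : AbsolutelyContinuousOnInterval
        (fun t => η t • V t - ∫ s in (-r)..t, (deriv η s • V s + η s • v s)) (-r) r := by
      refine AbsolutelyContinuousOnInterval.sub ?_
        ((hi1.add hi2).locallyIntegrable.absolutelyContinuousOnInterval _ _ _)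
      refine AbsolutelyContinuousOnInterval.smul ?_ (hv.absolutelyContinuousOnInterval _ _ _)
      exact (hη.of_le (by simp)).contDiffOn.absolutelyContinuousOnInterval
    obtain ⟨C, hC⟩ := hac.const_of_ae_hasDerivAt_zero (by
      filter_upwards [LocallyIntegrable.ae_hasDerivAt_integral hv,
        LocallyIntegrable.ae_hasDerivAt_integral (hi1.add hi2).locallyIntegrable] with t h1 h2 _
      have h3 := (((hη.differentiable (by simp)) t).hasDerivAt.smul (h1 c)).sub (h2 (-r))
      refine h3.congr_deriv ?_
      simp only [Pi.add_apply]
      rw [add_comm, sub_eq_zero])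
    have ha := hC (-r) (by simp)
    have hb := hC r (by simp)
    have e1 : η (-r) = 0 := hsupp _ (by rw [abs_neg, abs_of_pos hr0]; exact hRr)
    have e2 : η r = 0 := hsupp _ (by rw [abs_of_pos hr0]; exact hRr)
    simp only [e1, e2, zero_smul, intervalIntegral.integral_same, sub_zero, zero_sub] at ha hb
    rw [← ha] at hb
    simpa using hb
  rw [integral_add hi1 hi2] at hsum
  exact eq_neg_of_add_eq_zero_left hsum

/-- The **du Bois-Reymond lemma** on a half-line. -/
theorem ae_eq_const_of_integral_deriv_smul_eq_zero {w : ℝ → E} (hw : LocallyIntegrable w) (s₀ : ℝ)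
    (h : ∀ η : ℝ → ℝ, ContDiff ℝ ∞ η → HasCompactSupport η → tsupport η ⊆ Ioi s₀ →
      ∫ t, deriv η t • w t = 0) :
    ∃ c : E, ∀ᵐ t, t ∈ Ioi s₀ → w t = c := by
  let b : ContDiffBump (s₀ + 2) := ⟨1 / 2, 1, by norm_num, by norm_num⟩
  let ρ : ℝ → ℝ := b.normed volume
  have hρ : ContDiff ℝ ∞ ρ := b.contDiff_normed
  have hρc : HasCompactSupport ρ := b.hasCompactSupport_normed
  have hρs : tsupport ρ ⊆ Ioi s₀ := by
    intro x hx
    have : x ∈ Metric.closedBall (s₀ + 2) 1 := by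
      have := b.tsupport_normed_eq (μ := volume) ▸ hx
      exact this
    rw [Metric.mem_closedBall, Real.dist_eq] at this
    have := (abs_le.1 this).1
    simp only [mem_Ioi]; linarith
  have hρ1 : ∫ t, ρ t = 1 := b.integral_normed
  refine ⟨∫ t, ρ t • w t, ?_⟩
  set c := ∫ t, ρ t • w t with hc
  have hz := isOpen_Ioi.ae_eq_zero_of_integral_contDiff_smul_eq_zero (U := Ioi s₀) (μ := volume)
    (f := fun t => w t - c) ((hw.sub (locallyIntegrable_const c)).locallyIntegrableOn _) ?_
  · filter_upwards [hz] with t ht hts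
    exact sub_eq_zero.1 (ht hts)
  intro η hη hηc hηs
  set m := ∫ t, η t with hm
  have hηi : Integrable η := hη.continuous.integrable_of_hasCompactSupport hηc
  have hρi : Integrable ρ := hρ.continuous.integrable_of_hasCompactSupport hρc
  -- `g` has mean zero, so that its primitive `P` is again a test function
  set g : ℝ → ℝ := fun t => η t - m * ρ t with hg
  have hgs : ContDiff ℝ ∞ g := hη.sub (contDiff_const.mul hρ)
  have hg0 : ∫ t, g t = 0 := by
    rw [integral_sub hηi (hρi.const_mul m), integral_const_mul, hρ1, mul_one, sub_self]
  -- a compact interval inside `(s₀, ∞)` carrying `g`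
  obtain ⟨p, q, hp, hgpq⟩ : ∃ p q, s₀ < p ∧ ∀ t, t ∉ Icc p q → g t = 0 := by
    have hK : IsCompact (tsupport η ∪ tsupport ρ) := hηc.isCompact.union hρc.isCompact
    have hKne : (tsupport η ∪ tsupport ρ).Nonempty := by
      by_contra hne
      rw [not_nonempty_iff_eq_empty, union_empty_iff] at hne
      have : ρ = 0 := tsupport_eq_empty_iff.1 hne.2
      rw [this] at hρ1
      simp at hρ1
    obtain ⟨p, hpK, hp⟩ := hK.exists_isLeast hKne
    obtain ⟨q, -, hq⟩ := hK.exists_isGreatest hKne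
    refine ⟨p, q, (union_subset hηs hρs) hpK, fun t ht => ?_⟩
    have : t ∉ tsupport η ∪ tsupport ρ := fun h => ht ⟨hp h, hq h⟩
    rw [mem_union, not_or] at this
    simp [hg, image_eq_zero_of_notMem_tsupport this.1, image_eq_zero_of_notMem_tsupport this.2]
  set P : ℝ → ℝ := fun t => ∫ s in s₀..t, g s with hP
  have hPd : ∀ t, HasDerivAt P (g t) t := fun t =>
    intervalIntegral.integral_hasDerivAt_right (hgs.continuous.intervalIntegrable _ _)
      hgs.continuous.aestronglyMeasurable.stronglyMeasurableAtFilter hgs.continuous.continuousAt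
  have hPd' : deriv P = g := funext fun t => (hPd t).deriv
  have hPs : ContDiff ℝ ∞ P :=
    contDiff_infty_iff_deriv.2 ⟨fun t => (hPd t).differentiableAt, hPd' ▸ hgs⟩
  have hP0 : ∀ t, t ∉ Icc p q → P t = 0 := by
    intro t ht
    by_cases htp : t < p
    · have : EqOn g (fun _ => 0) (uIcc s₀ t) := by
        intro x hx
        refine hgpq x fun hx' => ?_
        have : x ≤ max s₀ t := hx.2
        have := this.trans_lt (max_lt hp htp)
        linarith [hx'.1]
      simp only [hP]
      rw [intervalIntegral.integral_congr this]
      simp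
    · have htq : q < t := by
        by_contra hn
        exact ht ⟨not_lt.1 htp, not_lt.1 hn⟩
      simp only [hP]
      rw [intervalIntegral.integral_eq_integral_of_support_subset, hg0]
      intro x hx
      have : x ∈ Icc p q := by
        by_contra hn
        exact hx (hgpq x hn)
      exact ⟨hp.trans_le this.1, this.2.trans htq.le⟩
  have hPts : tsupport P ⊆ Icc p q := closure_minimal
    (fun t ht => by by_contra hn; exact ht (hP0 t hn)) isClosed_Icc
  have hPc : HasCompactSupport P := isCompact_Icc.of_isClosed_subset (isClosed_tsupport _) hPts
  have h0 := h P hPs hPc (hPts.trans fun t ht => hp.trans_le ht.1)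
  rw [hPd'] at h0
  have i1 : Integrable fun t => η t • w t :=
    hw.integrable_smul_left_of_hasCompactSupport hη.continuous hηc
  have i2 : Integrable fun t => ρ t • w t :=
    hw.integrable_smul_left_of_hasCompactSupport hρ.continuous hρc
  have h1 : ∫ t, g t • w t = (∫ t, η t • w t) - m • c := by
    rw [hc, ← integral_smul, ← integral_sub i1 (i2.fun_smul m)]
    simp only [hg, sub_smul, mul_smul]
  simp only [smul_sub]
  rw [integral_sub i1 (hηi.smul_const c), integral_smul_const, ← hm, ← h1, h0]

/-- A locally integrable function with a locally integrable weak derivative is a.e. equal to a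
primitive of the latter. -/
theorem ae_eq_add_primitive_of_weakDeriv {u v : ℝ → E} (hu : LocallyIntegrable u)
    (hv : LocallyIntegrable v) (s₀ : ℝ)
    (h : ∀ η : ℝ → ℝ, ContDiff ℝ ∞ η → HasCompactSupport η → tsupport η ⊆ Ioi s₀ →
      ∫ t, deriv η t • u t = - ∫ t, η t • v t) :
    ∃ c : E, ∀ᵐ t, t ∈ Ioi s₀ → u t = c + ∫ s in s₀..t, v s := by
  have hVc : Continuous fun t => ∫ s in s₀..t, v s := intervalIntegral.continuous_primitive
    (hv.intervalIntegrable) s₀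
  obtain ⟨c, hc⟩ := ae_eq_const_of_integral_deriv_smul_eq_zero (hu.sub hVc.locallyIntegrable) s₀
    (fun η hη hηc hηs => by
      have hη' : Continuous (deriv η) := hη.continuous_deriv (by simp)
      simp only [Pi.sub_apply, smul_sub]
      rw [integral_sub (hu.integrable_smul_left_of_hasCompactSupport hη' hηc.deriv)
        (hVc.locallyIntegrable.integrable_smul_left_of_hasCompactSupport hη' hηc.deriv),
        h η hη hηc hηs, integral_deriv_smul_primitive hv s₀ hη hηc, sub_self])
  refine ⟨c, ?_⟩
  filter_upwards [hc] with t ht hts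
  rw [← ht hts, Pi.sub_apply, sub_add_cancel]

end

/-! ### The energy identity for the derivative -/

section

variable {E : Type*} [NormedAddCommGroup E] [InnerProductSpace ℝ E]

theorem absolutelyContinuousOnInterval_normSq_primitive {v : ℝ → E} (hv : LocallyIntegrable v)
    (c : E) (s₀ : ℝ) (L : E →L[ℝ] E) (a b : ℝ) :
    AbsolutelyContinuousOnInterval (fun t => ‖L (c + ∫ s in s₀..t, v s)‖ ^ 2) a b := by
  have h : AbsolutelyContinuousOnInterval (fun t => ‖L (c + ∫ s in s₀..t, v s)‖) a b := by
    refine (hv.absolutelyContinuousOnInterval a b s₀).of_dist_le (K := ‖L‖) fun x _ y _ => ?_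
    rw [Real.dist_eq, dist_eq_norm]
    refine (abs_norm_sub_norm_le _ _).trans ?_
    rw [← map_sub, add_sub_add_left_eq_sub]
    exact L.le_opNorm _
  simpa only [sq] using h.fun_mul h

variable [CompleteSpace E]

theorem ae_hasDerivAt_normSq_primitive {v : ℝ → E} (hv : LocallyIntegrable v)
    (c : E) (s₀ : ℝ) (L : E →L[ℝ] E) :
    ∀ᵐ x, HasDerivAt (fun t => ‖L (c + ∫ s in s₀..t, v s)‖ ^ 2)
      (2 * inner ℝ (L (c + ∫ s in s₀..x, v s)) (L (v x))) x := by
  filter_upwards [LocallyIntegrable.ae_hasDerivAt_integral hv] with x hx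
  exact (L.hasFDerivAt.comp_hasDerivAt x ((hx s₀).const_add c)).norm_sq

theorem normSq_primitive_sub {v : ℝ → E} (hv : LocallyIntegrable v)
    (c : E) (s₀ : ℝ) (L : E →L[ℝ] E) (a b : ℝ) :
    ‖L (c + ∫ s in s₀..b, v s)‖ ^ 2 - ‖L (c + ∫ s in s₀..a, v s)‖ ^ 2
      = ∫ x in a..b, 2 * inner ℝ (L (c + ∫ s in s₀..x, v s)) (L (v x)) := by
  rw [← (absolutelyContinuousOnInterval_normSq_primitive hv c s₀ L a b).integral_deriv_eq_sub]
  refine intervalIntegral.integral_congr_ae ?_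
  filter_upwards [ae_hasDerivAt_normSq_primitive hv c s₀ L] with x hx _ using hx.deriv

/-- Absolute continuity of `t ↦ ‖g t‖²` up to null sets, to be read with `v = U_t`, `g = U_x` and
`w = U_xx`. It says `d/dt ‖U_x‖² = -2 ⟪U_xx, U_t⟫` without asking for `U_tx`: the bounded operators
`Q n` approximate `d/dx`, so that `‖Q n U‖²` is absolutely continuous, and its derivative
`-2 ⟪S n w, v⟫` converges in `L¹` on bounded intervals. -/
theorem exists_primitive_normSq_of_approx {v w g U : ℝ → E} {c : E} {s₀ : ℝ}
    {Q S : ℕ → E →L[ℝ] E}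
    (hv : LocallyIntegrable v) (hw : AEStronglyMeasurable w)
    (hwv : LocallyIntegrable fun t => ‖w t‖ * ‖v t‖)
    (hU : ∀ t, U t = c + ∫ s in s₀..t, v s)
    (hSle : ∀ n f, ‖S n f‖ ≤ ‖f‖) (hS : ∀ f, Tendsto (fun n => S n f) atTop (𝓝 f))
    (hQ : ∀ᵐ t, s₀ < t → Tendsto (fun n => ‖Q n (U t)‖) atTop (𝓝 ‖g t‖))
    (hQS : ∀ᵐ t, s₀ < t → ∀ n x, inner ℝ (Q n (U t)) (Q n x) = - inner ℝ (S n (w t)) x) :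
    ∃ D : ℝ → ℝ, (∀ t, s₀ ≤ t → 0 ≤ D t) ∧ (∀ᵐ t, s₀ < t → D t = ‖g t‖ ^ 2) ∧
      (∀ a b, AbsolutelyContinuousOnInterval D a b) ∧
      ∀ᵐ t, HasDerivAt D (-(2 * inner ℝ (w t) (v t))) t := by
  have hvm : AEStronglyMeasurable v := hv.aestronglyMeasurable
  obtain ⟨s₁, hs₁, hs₁Q⟩ : ∃ s₁, s₀ < s₁ ∧
      Tendsto (fun n => ‖Q n (U s₁)‖) atTop (𝓝 ‖g s₁‖) := by
    have hne : NeBot (ae (volume.restrict (Ioi s₀))) := by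
      rw [ae_neBot, Ne, Measure.restrict_eq_zero]
      simp
    have := (ae_restrict_mem (μ := volume) (measurableSet_Ioi (a := s₀))).and
      (ae_restrict_of_ae (s := Ioi s₀) hQ)
    obtain ⟨t, ht, ht'⟩ := this.exists
    exact ⟨t, ht, ht' ht⟩
  set d : ℝ → ℝ := fun t => -(2 * inner ℝ (w t) (v t)) with hd
  have hdi : LocallyIntegrable d := by
    refine (hwv.smul (2 : ℝ)).mono ((hw.inner hvm).const_mul 2).neg
      (Eventually.of_forall fun t => ?_)
    simp only [hd, norm_neg, norm_mul, Pi.smul_apply, smul_eq_mul, norm_norm, Real.norm_ofNat]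
    gcongr
    exact norm_inner_le_norm _ _
  set D : ℝ → ℝ := fun t => ‖g s₁‖ ^ 2 + ∫ s in s₁..t, d s with hD
  have hconv : ∀ t, s₀ ≤ t → Tendsto (fun n => ‖Q n (U t)‖ ^ 2) atTop (𝓝 (D t)) := by
    intro t ht
    have h1 : ∀ n, ‖Q n (U t)‖ ^ 2 = ‖Q n (U s₁)‖ ^ 2
        + ∫ x in s₁..t, -(2 * inner ℝ (S n (w x)) (v x)) := by
      intro n
      have h2 := normSq_primitive_sub hv c s₀ (Q n) s₁ t
      simp only [← hU] at h2
      rw [← sub_eq_iff_eq_add', h2]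
      refine intervalIntegral.integral_congr_ae ?_
      filter_upwards [hQS] with x hx hxt
      have : s₀ < x := (le_min hs₁.le ht).trans_lt hxt.1
      rw [hx this n, mul_neg]
    simp_rw [h1]
    refine (hs₁Q.pow 2).add ?_
    refine intervalIntegral.tendsto_integral_filter_of_dominated_convergence
      (fun x => 2 * (‖w x‖ * ‖v x‖)) ?_ ?_ ?_ ?_
    · refine Eventually.of_forall fun n => ?_
      have : AEStronglyMeasurable (fun x => S n (w x)) :=
        (S n).continuous.comp_aestronglyMeasurable hw
      exact ((this.inner hvm).const_mul 2).neg.restrict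
    · refine Eventually.of_forall fun n => Eventually.of_forall fun x _ => ?_
      rw [norm_neg, norm_mul, Real.norm_ofNat]
      gcongr
      refine (norm_inner_le_norm _ _).trans ?_
      gcongr
      exact hSle n _
    · exact (hwv.intervalIntegrable _ _).const_mul 2
    · exact Eventually.of_forall fun x _ =>
        (((hS (w x)).inner tendsto_const_nhds).const_mul 2).neg
  refine ⟨D, fun t ht => ge_of_tendsto' (hconv t ht) fun n => sq_nonneg _, ?_, ?_, ?_⟩
  · filter_upwards [hQ] with t ht hts
    exact tendsto_nhds_unique (hconv t hts.le) ((ht hts).pow 2)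
  · intro a b
    refine (hdi.absolutelyContinuousOnInterval a b s₁).of_dist_le (K := 1) fun x _ y _ => ?_
    simp [hD]
  · filter_upwards [LocallyIntegrable.ae_hasDerivAt_integral hdi] with x hx
    exact (hx s₁).const_add _

end

/-! ### The differential inequality for the frequency function -/

theorem AbsolutelyContinuousOnInterval.sub_le_integral {f g : ℝ → ℝ} {a b : ℝ} (hab : a ≤ b)
    (hf : AbsolutelyContinuousOnInterval f a b) (hg : IntervalIntegrable g volume a b)
    (h : ∀ᵐ x, a < x → x ≤ b → ∃ f', HasDerivAt f f' x ∧ f' ≤ g x) :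
    f b - f a ≤ ∫ x in a..b, g x := by
  rw [← hf.integral_deriv_eq_sub]
  refine intervalIntegral.integral_mono_ae_restrict hab hf.intervalIntegrable_deriv hg ?_
  rw [← restrict_Ioc_eq_restrict_Icc]
  filter_upwards [ae_restrict_of_ae h, ae_restrict_mem measurableSet_Ioc] with x hx hxm
  obtain ⟨f', h1, h2⟩ := hx hxm.1 hxm.2
  rwa [h1.deriv]

theorem AbsolutelyContinuousOnInterval.log {f : ℝ → ℝ} {a b : ℝ}
    (hf : AbsolutelyContinuousOnInterval f a b) (hpos : ∀ x ∈ uIcc a b, 0 < f x) :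
    AbsolutelyContinuousOnInterval (fun x => Real.log (f x)) a b := by
  obtain ⟨x₀, hx₀, hmin⟩ := isCompact_uIcc.exists_isMinOn nonempty_uIcc hf.continuousOn
  have hm := hpos x₀ hx₀
  refine hf.of_dist_le (K := (f x₀)⁻¹) fun x hx y hy => ?_
  have key : ∀ p q, f x₀ ≤ p → f x₀ ≤ q → Real.log p - Real.log q ≤ (f x₀)⁻¹ * |p - q| := by
    intro p q hp hq
    have hp0 := hm.trans_le hp
    have hq0 := hm.trans_le hq
    rw [← Real.log_div hp0.ne' hq0.ne']
    calc Real.log (p / q) ≤ p / q - 1 := Real.log_le_sub_one_of_pos (by positivity)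
      _ = q⁻¹ * (p - q) := by field_simp
      _ ≤ q⁻¹ * |p - q| := by gcongr; exact le_abs_self _
      _ ≤ (f x₀)⁻¹ * |p - q| := by gcongr
  rw [Real.dist_eq, Real.dist_eq, abs_le]
  have h1 := key _ _ (hmin hx) (hmin hy)
  have h2 := key _ _ (hmin hy) (hmin hx)
  rw [abs_sub_comm (f y)] at h2
  constructor <;> linarith

/-- The frequency function argument for scalar functions; `H` stands for `‖u‖²`, `D` for `‖u_x‖²`.
By `hfreq` the derivative of `log ((H + D) / H)` is at most `Λ φ / 2`, which is integrable, so
`D / H` stays bounded as long as `H` is positive. By `hdecay` the derivative of `log H` is then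
bounded below by a constant minus an integrable function. This lower bound also keeps `H` from
reaching zero. -/
theorem exists_exp_le_of_frequency_bound {H D h d φ : ℝ → ℝ} {Λ s : ℝ} (hΛ : 0 ≤ Λ)
    (hHc : Continuous H) (hHac : ∀ a b, AbsolutelyContinuousOnInterval H a b)
    (hDac : ∀ a b, AbsolutelyContinuousOnInterval D a b)
    (hD0 : ∀ t, s ≤ t → 0 ≤ D t)
    (hHd : ∀ᵐ t, HasDerivAt H (h t) t) (hDd : ∀ᵐ t, HasDerivAt D (d t) t)
    (hφ : IntegrableOn φ (Ioi s)) (hφ0 : ∀ᵐ t, s < t → 0 ≤ φ t)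
    (hfreq : ∀ᵐ t, s < t →
      H t * (d t * H t - D t * h t) ≤ Λ / 2 * φ t * (H t + D t) * H t ^ 2)
    (hdecay : ∀ᵐ t, s < t → -(2 * Λ * D t + H t + φ t * (H t + D t)) ≤ h t)
    (hs : 0 < H s) :
    ∃ C c : ℝ, 0 < c ∧ ∀ t, s ≤ t → c * Real.exp (-(C * (t - s))) ≤ H t := by
  set Φ := ∫ t in Ioi s, φ t with hΦ
  have hφi : ∀ t, s ≤ t → IntervalIntegrable φ volume s t := fun t ht =>
    (intervalIntegrable_iff_integrableOn_Ioc_of_le ht).2 (hφ.mono_set Ioc_subset_Ioi_self)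
  have hφΦ : ∀ t, s ≤ t → ∫ x in s..t, φ x ≤ Φ := by
    intro t ht
    rw [intervalIntegral.integral_of_le ht]
    exact setIntegral_mono_set hφ ((ae_restrict_iff' measurableSet_Ioi).2 hφ0)
      (Ioc_subset_Ioi_self.eventuallyLE)
  set G : ℝ → ℝ := fun t => Real.log (H t + D t) - Real.log (H t) with hG
  set K := Real.exp (G s + Λ / 2 * Φ) with hK
  have hK0 : 0 < K := Real.exp_pos _
  -- as long as `H` is positive, the frequency `D / H` stays bounded
  have hquot : ∀ t, s ≤ t → (∀ x ∈ Icc s t, 0 < H x) → H t + D t ≤ K * H t := by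
    intro t ht hpos
    have hpos' : ∀ x ∈ uIcc s t, 0 < H x := by rwa [uIcc_of_le ht]
    have hposD : ∀ x ∈ uIcc s t, 0 < H x + D x := fun x hx =>
      add_pos_of_pos_of_nonneg (hpos' x hx) (hD0 x (by rw [uIcc_of_le ht] at hx; exact hx.1))
    have hGac : AbsolutelyContinuousOnInterval G s t :=
      (((hHac s t).add (hDac s t)).log hposD).sub ((hHac s t).log hpos')
    have hGle : G t - G s ≤ ∫ x in s..t, Λ / 2 * φ x := by
      refine hGac.sub_le_integral ht ((hφi t ht).const_mul _) ?_
      filter_upwards [hHd, hDd, hfreq] with x h1 h2 h3 hsx hxt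
      have hx : x ∈ uIcc s t := by rw [uIcc_of_le ht]; exact ⟨hsx.le, hxt⟩
      have p1 := hpos' x hx
      have p2 := hposD x hx
      refine ⟨_, ((h1.add h2).log p2.ne').sub (h1.log p1.ne'), ?_⟩
      have h4 : d x * H x - D x * h x ≤ Λ / 2 * φ x * (H x + D x) * H x := by
        refine le_of_mul_le_mul_left ?_ p1
        calc _ ≤ _ := h3 hsx
          _ = _ := by ring
      rw [Pi.add_apply, div_sub_div _ _ p2.ne' p1.ne', div_le_iff₀ (by positivity)]
      linarith
    rw [intervalIntegral.integral_const_mul] at hGle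
    have h5 : G t ≤ G s + Λ / 2 * Φ := by
      have : Λ / 2 * ∫ x in s..t, φ x ≤ Λ / 2 * Φ := by gcongr; exact hφΦ t ht
      linarith
    have p1 := hpos' t right_mem_uIcc
    have p2 := hposD t right_mem_uIcc
    have h6 : Real.exp (G t) ≤ K := Real.exp_le_exp.2 h5
    simp only [hG] at h6
    rw [Real.exp_sub, Real.exp_log p2, Real.exp_log p1, div_le_iff₀ p1] at h6
    exact h6
  set C := 2 * Λ * K + 1 with hC
  have hC0 : 0 < C := by positivity
  set c := Real.exp (Real.log (H s) - K * Φ) with hc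
  have hlow : ∀ t, s ≤ t → (∀ x ∈ Icc s t, 0 < H x) → c * Real.exp (-(C * (t - s))) ≤ H t := by
    intro t ht hpos
    have hpos' : ∀ x ∈ uIcc s t, 0 < H x := by rwa [uIcc_of_le ht]
    have hle : -Real.log (H t) - -Real.log (H s) ≤ ∫ x in s..t, (C + K * φ x) := by
      refine AbsolutelyContinuousOnInterval.sub_le_integral (f := fun x => -Real.log (H x)) ht
        ((hHac s t).log hpos').neg
        (intervalIntegrable_const.add ((hφi t ht).const_mul _)) ?_
      filter_upwards [hHd, hdecay, hφ0] with x h1 h2 h3 hsx hxt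
      have hx : x ∈ Icc s t := ⟨hsx.le, hxt⟩
      have p1 := hpos x hx
      refine ⟨_, (h1.log p1.ne').neg, ?_⟩
      have h4 := hquot x hsx.le fun y hy => hpos y ⟨hy.1, hy.2.trans hxt⟩
      have h5 := h2 hsx
      have h6 := h3 hsx
      rw [← neg_div, div_le_iff₀ p1]
      have h7 : φ x * (H x + D x) ≤ φ x * (K * H x) := by gcongr
      have h8 : 2 * Λ * D x ≤ 2 * Λ * (K * H x) := by
        have : D x ≤ K * H x := by linarith
        gcongr
      rw [hC]
      linarith
    rw [intervalIntegral.integral_add intervalIntegrable_const ((hφi t ht).const_mul _),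
      intervalIntegral.integral_const_mul, intervalIntegral.integral_const, smul_eq_mul] at hle
    have h9 : K * ∫ x in s..t, φ x ≤ K * Φ := by gcongr; exact hφΦ t ht
    rw [hc, ← Real.exp_add, ← Real.le_log_iff_exp_le (hpos t (right_mem_Icc.2 ht))]
    linarith
  refine ⟨C, c, Real.exp_pos _, ?_⟩
  have hposall : ∀ t, s ≤ t → 0 < H t := by
    by_contra! hcon
    obtain ⟨t₁, ht₁, hHt₁⟩ := hcon
    -- the first zero of `H`
    set Z := Ici s ∩ H ⁻¹' Iic 0 with hZ
    have hZc : IsClosed Z := isClosed_Ici.inter (isClosed_Iic.preimage hHc)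
    have hZb : BddBelow Z := ⟨s, fun t ht => ht.1⟩
    have hT : sInf Z ∈ Z := hZc.csInf_mem ⟨t₁, ht₁, hHt₁⟩ hZb
    set T := sInf Z with hTdef
    have hsT : s < T := lt_of_le_of_ne hT.1 fun he => by
      have := hT.2
      rw [mem_preimage, ← he, mem_Iic] at this
      linarith
    have hbefore : ∀ t ∈ Ico s T, 0 < H t := by
      intro t ht
      by_contra hn
      exact (csInf_le hZb ⟨ht.1, not_lt.1 hn⟩).not_gt ht.2
    have hlim : c * Real.exp (-(C * (T - s))) ≤ H T := by
      have : NeBot (𝓝[Ico s T] T) := by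
        rw [← mem_closure_iff_nhdsWithin_neBot, closure_Ico hsT.ne]
        exact right_mem_Icc.2 hsT.le
      have hcont : Tendsto H (𝓝[Ico s T] T) (𝓝 (H T)) := hHc.continuousWithinAt
      refine ge_of_tendsto hcont ?_
      filter_upwards [self_mem_nhdsWithin] with t ht
      refine le_trans ?_ (hlow t ht.1 fun x hx => hbefore x ⟨hx.1, hx.2.trans_lt ht.2⟩)
      have := ht.2.le
      have h0 : 0 < c := Real.exp_pos _
      gcongr
    have : 0 < c * Real.exp (-(C * (T - s))) := mul_pos (Real.exp_pos _) (Real.exp_pos _)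
    have := hT.2
    rw [mem_preimage, mem_Iic] at this
    linarith
  exact fun t ht => hlow t ht fun x hx => hposall x hx.1

/-! ### Pointwise estimates for the equation -/

theorem IsWeakDerivX.inner_eq_neg_norm_sq {f g k : L2R} (hfg : IsWeakDerivX f g)
    (hgk : IsWeakDerivX g k) : inner ℝ k f = -‖g‖ ^ 2 := by
  obtain ⟨Q, S, -, hS, hQ, hQS⟩ := exists_bounded_approx_deriv
  have h1 : Tendsto (fun n => ‖Q n f‖ ^ 2) atTop (𝓝 (‖g‖ ^ 2)) := (hQ f g hfg).pow 2
  have h2 : Tendsto (fun n => -inner ℝ (S n k) f) atTop (𝓝 (-inner ℝ k f)) :=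
    ((hS k).inner tendsto_const_nhds).neg
  have h3 : ∀ n, ‖Q n f‖ ^ 2 = -inner ℝ (S n k) f := fun n => by
    rw [← real_inner_self_eq_norm_sq, hQS f g k hfg hgk]
  simp_rw [h3] at h1
  linarith [tendsto_nhds_unique h1 h2]

section

variable {E : Type*} [NormedAddCommGroup E] [InnerProductSpace ℝ E]

/-- With `u`, `w = u_xx`, `v = u_t`, `D = ‖u_x‖²` and `H = ‖u‖²`, the left-hand side is
`H (D' H - D H')`, the numerator of the derivative of the frequency `D / H` up to a factor `H`.
Decomposing `H u_xx = z - D u` with `z` orthogonal to `u`, it equals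
`-2 a ‖z‖² - 2 H ⟪z, u_t - a u_xx⟫`, where the first term has the good sign. -/
theorem frequency_deriv_numerator_le {u w v : E} {a Λ φ D : ℝ} (hΛ : 0 < Λ) (ha : Λ⁻¹ ≤ a)
    (hwu : inner ℝ w u = -D) (hf : ‖v - a • w‖ ^ 2 ≤ φ * (‖u‖ ^ 2 + D)) :
    ‖u‖ ^ 2 * (-(2 * inner ℝ w v) * ‖u‖ ^ 2 - D * (2 * inner ℝ u v))
      ≤ Λ / 2 * φ * (‖u‖ ^ 2 + D) * (‖u‖ ^ 2) ^ 2 := by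
  set H := ‖u‖ ^ 2 with hH
  set f := v - a • w with hfdef
  have hv : v = f + a • w := by rw [hfdef]; abel
  -- the component of `H • w` orthogonal to `u`
  set z := H • w + D • u with hz
  have hzu : inner ℝ z u = 0 := by
    rw [hz, inner_add_left, real_inner_smul_left, real_inner_smul_left, hwu,
      real_inner_self_eq_norm_sq]
    ring
  have hHw : H • w = z - D • u := by rw [hz]; abel
  have hzv : H * inner ℝ z v = H * inner ℝ z f + a * ‖z‖ ^ 2 := by
    have : inner ℝ z (H • w) = ‖z‖ ^ 2 := by
      rw [hHw, inner_sub_right, real_inner_smul_right, hzu, real_inner_self_eq_norm_sq]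
      ring
    rw [real_inner_smul_right] at this
    rw [hv, inner_add_right, real_inner_smul_right, ← this]
    ring
  have hlhs : H * (-(2 * inner ℝ w v) * H - D * (2 * inner ℝ u v))
      = -2 * (H * inner ℝ z f + a * ‖z‖ ^ 2) := by
    rw [← hzv, hz, inner_add_left, real_inner_smul_left, real_inner_smul_left]
    ring
  rw [hlhs]
  have hH0 : 0 ≤ H := sq_nonneg _
  have h1 : -(H * inner ℝ z f) ≤ H * (‖z‖ * ‖f‖) := by
    have := (abs_le.1 (abs_real_inner_le_norm z f)).1
    nlinarith
  have h2 : Λ⁻¹ * ‖z‖ ^ 2 ≤ a * ‖z‖ ^ 2 := by gcongr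
  -- Young's inequality
  have h3 : 2 * (H * (‖z‖ * ‖f‖)) ≤ 2 * (Λ⁻¹ * ‖z‖ ^ 2) + Λ / 2 * (H ^ 2 * ‖f‖ ^ 2) := by
    have h4 : 0 ≤ Λ⁻¹ * 2 * (‖z‖ - Λ / 2 * (H * ‖f‖)) ^ 2 := by positivity
    have h5 : Λ⁻¹ * 2 * (‖z‖ - Λ / 2 * (H * ‖f‖)) ^ 2
        = 2 * (Λ⁻¹ * ‖z‖ ^ 2) + Λ / 2 * (H ^ 2 * ‖f‖ ^ 2) - 2 * (H * (‖z‖ * ‖f‖)) := by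
      field_simp
      ring
    linarith
  have h6 : Λ / 2 * (H ^ 2 * ‖f‖ ^ 2) ≤ Λ / 2 * (H ^ 2 * (φ * (H + D))) := by gcongr
  linarith

/-- A lower bound for `d/dt ‖u‖² = 2 ⟪u, u_t⟫`, with `w = u_xx`, `v = u_t` and `D = ‖u_x‖²`. -/
theorem neg_le_energy_deriv {u w v : E} {a Λ φ D : ℝ} (ha : a ≤ Λ) (hD : 0 ≤ D)
    (hwu : inner ℝ w u = -D) (hf : ‖v - a • w‖ ^ 2 ≤ φ * (‖u‖ ^ 2 + D)) :
    -(2 * Λ * D + ‖u‖ ^ 2 + φ * (‖u‖ ^ 2 + D)) ≤ 2 * inner ℝ u v := by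
  have hv : v = (v - a • w) + a • w := by abel
  have h1 : inner ℝ u v = inner ℝ u (v - a • w) - a * D := by
    conv_lhs => rw [hv]
    rw [inner_add_right, real_inner_smul_right, real_inner_comm w u, hwu]
    ring
  have h2 := (abs_le.1 (abs_real_inner_le_norm u (v - a • w))).1
  have h3 := two_mul_le_add_sq ‖u‖ ‖v - a • w‖
  have h4 : a * D ≤ Λ * D := by gcongr
  linarith

end

/-! ### The continuous representative in time -/

theorem locallyIntegrable_indicator_Ici {E : Type*} [NormedAddCommGroup E] {f : ℝ → E} {s : ℝ}
    (h : ∀ T, IntegrableOn f (Icc s T)) : LocallyIntegrable ((Ici s).indicator f) := by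
  rw [locallyIntegrable_iff]
  intro K hK
  obtain ⟨R, hR⟩ := hK.bddAbove
  rw [IntegrableOn, integrable_indicator_iff measurableSet_Ici, IntegrableOn,
    Measure.restrict_restrict measurableSet_Ici]
  exact (h R).mono_set fun x hx => ⟨hx.1, hR hx.2⟩

theorem MemL2Loc.integrableOn {E : Type*} [NormedAddCommGroup E] {f : ℝ → E} (hf : MemL2Loc f)
    {s : ℝ} (hs : 0 < s) (T : ℝ) : IntegrableOn f (Icc s T) :=
  (hf s T hs).integrable one_le_two

theorem MemL2Loc.integrableOn_norm_mul_norm {E F : Type*} [NormedAddCommGroup E]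
    [NormedAddCommGroup F] {f : ℝ → E} {g : ℝ → F} (hf : MemL2Loc f) (hg : MemL2Loc g)
    {s : ℝ} (hs : 0 < s) (T : ℝ) : IntegrableOn (fun t => ‖f t‖ * ‖g t‖) (Icc s T) :=
  (hf s T hs).norm.integrable_mul (hg s T hs).norm

/-- Away from `t = 0`, a function in `H¹_loc((0, ∞); L²(ℝ))` agrees a.e. with a primitive of its
weak derivative. The derivative is cut off below `s` because nothing is known about its
integrability near `0`. -/
theorem IsWeakDerivT.exists_primitive {u v : ℝ → L2R} (h : IsWeakDerivT u v) (hu : MemL2Loc u)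
    (hv : MemL2Loc v) {s : ℝ} (hs : 0 < s) :
    ∃ c : L2R, ∀ᵐ t, s < t → u t = c + ∫ x in s..t, (Ici s).indicator v x := by
  obtain ⟨c, hc⟩ := ae_eq_add_primitive_of_weakDeriv
    (locallyIntegrable_indicator_Ici (hu.integrableOn hs))
    (locallyIntegrable_indicator_Ici (hv.integrableOn hs)) s (fun η hη hηc hηs => by
      have key : ∀ (ζ : ℝ → ℝ) (f : ℝ → L2R), (∀ t, t ∉ tsupport η → ζ t = 0) →
          ∫ t, ζ t • (Ici s).indicator f t = ∫ t in Ioi (0 : ℝ), ζ t • f t := by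
        intro ζ f hζ
        rw [setIntegral_eq_integral_of_forall_compl_eq_zero]
        · congr 1
          ext1 t
          by_cases ht : t ∈ tsupport η
          · rw [indicator_of_mem (mem_Ici.2 (mem_Ioi.1 (hηs ht)).le)]
          · simp [hζ t ht]
        · intro t ht
          rw [hζ t fun h => ht (hs.trans (hηs h)), zero_smul]
      rw [key _ u fun t ht => image_eq_zero_of_notMem_tsupport
          fun h => ht (tsupport_deriv_subset (𝕜 := ℝ) h),
        key _ v fun t ht => image_eq_zero_of_notMem_tsupport ht]
      exact h η hη hηc (hηs.trans (Ioi_subset_Ioi hs.le)))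
  refine ⟨c, ?_⟩
  filter_upwards [hc] with t ht hst
  rw [← ht hst, indicator_of_mem (mem_Ici.2 hst.le)]

/-! ### Unique continuation at infinity -/

theorem neBot_atTop_inf_ae : NeBot (atTop ⊓ ae (volume : Measure ℝ)) := by
  rw [inf_neBot_iff]
  intro s hs t ht
  obtain ⟨a, ha⟩ := mem_atTop_sets.1 hs
  have hne : NeBot (ae ((volume : Measure ℝ).restrict (Ici a))) := by
    rw [ae_neBot, Ne, Measure.restrict_eq_zero]
    simp
  have hmem : Ici a ∩ t ∈ ae ((volume : Measure ℝ).restrict (Ici a)) :=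
    inter_mem (ae_restrict_mem measurableSet_Ici) (ae_restrict_of_ae ht)
  obtain ⟨x, hx, hxt⟩ := hne.nonempty_of_mem hmem
  exact ⟨x, ha x hx, hxt⟩

theorem theorem1 (a φ ψ μ : ℝ → ℝ) (Λ₀ : ℝ)
    (hΛ₀ : 1 ≤ Λ₀)
    (ha_cont : ContinuousOn a (Ici 0))
    (ha_bound : ∀ t, 0 ≤ t → Λ₀⁻¹ ≤ a t ∧ a t ≤ Λ₀)
    (hφ_nonneg : ∀ᵐ t ∂(volume.restrict (Ioi (0 : ℝ))), 0 ≤ φ t)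
    (hφ_int : MemLp φ 1 (volume.restrict (Ioi (0 : ℝ))))
    (hμ : IsModulusOfContinuity μ)
    (hμ_osgood : OsgoodCondition μ)
    (hψ_nonneg : ∀ᵐ t ∂(volume.restrict (Ioi (0 : ℝ))), 0 ≤ ψ t)
    (hψ_int : MemLp ψ 1 (volume.restrict (Ioi (0 : ℝ))))
    (hψ_bdd : MemLp ψ ∞ (volume.restrict (Ioi (0 : ℝ))))
    (haψ : ∀ᵐ t ∂(volume.restrict (Ioi (0 : ℝ))),
      ∀ t₁ t₂ : ℝ, max 0 (t - 1 / 2) < t₁ → t₁ < t₂ → t₂ < t + 1 / 2 →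
        |a t₂ - a t₁| / μ (t₂ - t₁) ≤ ψ t)
    (u : ℝ → L2R) (hu : IsRapidlyDecayingSolution a φ u) :
    ∀ᵐ t ∂(volume.restrict (Ioi (0 : ℝ))), u t = 0 := by
  obtain ⟨ut, ux, uxx, hH2, hH1, hineq, hlim⟩ := hu
  have hΛpos : 0 < Λ₀ := by linarith
  suffices hmain : ∀ s₀ : ℝ, 0 < s₀ → ∀ᵐ t, s₀ < t → u t = 0 by
    rw [ae_restrict_iff' measurableSet_Ioi]
    filter_upwards [ae_all_iff.2 fun n : ℕ => hmain (1 / ((n : ℝ) + 1)) (by positivity)]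
      with t ht ht0
    obtain ⟨n, hn⟩ := exists_nat_one_div_lt (mem_Ioi.1 ht0)
    exact ht n hn
  intro s₀ hs₀
  -- conditions holding for a.e. positive time, rephrased for times after `s₀`
  have lift : ∀ {p : ℝ → Prop}, (∀ᵐ t ∂(volume.restrict (Ioi (0 : ℝ))), p t) →
      ∀ᵐ t, s₀ < t → p t := by
    intro p hp
    rw [ae_restrict_iff' measurableSet_Ioi] at hp
    filter_upwards [hp] with t ht hst using ht (hs₀.trans hst)
  set v := (Ici s₀).indicator ut with hvdef
  set w := (Ici s₀).indicator uxx with hwdef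
  have hv : LocallyIntegrable v :=
    locallyIntegrable_indicator_Ici (hH1.memL2Loc_dt.integrableOn hs₀)
  have hw : LocallyIntegrable w :=
    locallyIntegrable_indicator_Ici (hH2.memL2Loc_dxx.integrableOn hs₀)
  have hwv : LocallyIntegrable fun t => ‖w t‖ * ‖v t‖ := by
    have := locallyIntegrable_indicator_Ici
      (hH2.memL2Loc_dxx.integrableOn_norm_mul_norm hH1.memL2Loc_dt hs₀)
    convert this using 1
    ext t
    by_cases ht : t ∈ Ici s₀ <;> simp [hvdef, hwdef, ht]
  have hvt : ∀ t, s₀ < t → v t = ut t := fun t ht => indicator_of_mem (mem_Ici.2 ht.le) _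
  have hwt : ∀ t, s₀ < t → w t = uxx t := fun t ht => indicator_of_mem (mem_Ici.2 ht.le) _
  obtain ⟨c, hc⟩ := hH1.weakDeriv_dt.exists_primitive hH1.memL2Loc hH1.memL2Loc_dt hs₀
  set U : ℝ → L2R := fun t => c + ∫ x in s₀..t, v x with hU
  have hUc : Continuous U :=
    continuous_const.add (intervalIntegral.continuous_primitive hv.intervalIntegrable s₀)
  -- `D` is the continuous representative of `‖u_x‖²`
  obtain ⟨Q, S, hSle, hS, hQ, hQS⟩ := exists_bounded_approx_deriv
  have hdx := lift hH2.weakDeriv_dx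
  have hdxx := lift hH2.weakDeriv_dxx
  obtain ⟨D, hD0, hDux, hDac, hDd⟩ := exists_primitive_normSq_of_approx (g := ux) hv
    hw.aestronglyMeasurable hwv (fun t => rfl : ∀ t, U t = _) hSle hS
    (by
      filter_upwards [hc, hdx] with t h1 h2 ht
      have : U t = u t := (h1 ht).symm
      rw [this]
      exact hQ _ _ (h2 ht))
    (by
      filter_upwards [hc, hdx, hdxx] with t h1 h2 h3 ht n x
      have : U t = u t := (h1 ht).symm
      rw [this, hwt t ht]
      exact hQS _ _ _ (h2 ht) (h3 ht) n x)
  have hpt : ∀ᵐ t, s₀ < t → U t = u t ∧ inner ℝ (w t) (U t) = -D t ∧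
      ‖v t - a t • w t‖ ^ 2 ≤ φ t * (‖U t‖ ^ 2 + D t) := by
    filter_upwards [hc, hdx, hdxx, hDux, lift hineq] with t h1 h2 h3 h4 h5 ht
    have hUu : U t = u t := (h1 ht).symm
    refine ⟨hUu, ?_, ?_⟩
    · rw [hUu, hwt t ht, h4 ht]
      exact (h2 ht).inner_eq_neg_norm_sq (h3 ht)
    · rw [hUu, hwt t ht, hvt t ht, h4 ht]
      have := h5 ht
      rwa [normH1, Real.sq_sqrt (by positivity)] at this
  have hzero : ∀ s, s₀ < s → U s = 0 := by
    intro s hs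
    by_contra hne
    obtain ⟨C, k, hk, hlow⟩ := exists_exp_le_of_frequency_bound (H := fun t => ‖U t‖ ^ 2) (D := D)
      (φ := φ) (s := s) hΛpos.le (hUc.norm.pow 2)
      (absolutelyContinuousOnInterval_normSq_primitive hv c s₀ (ContinuousLinearMap.id ℝ L2R))
      hDac (fun t ht => hD0 t (hs.le.trans ht))
      (ae_hasDerivAt_normSq_primitive hv c s₀ (ContinuousLinearMap.id ℝ L2R)) hDd
      ((memLp_one_iff_integrable.1 hφ_int).mono_measure
        (Measure.restrict_mono (Ioi_subset_Ioi (hs₀.trans hs).le) le_rfl))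
      (by filter_upwards [lift hφ_nonneg] with t ht hst using ht (hs.trans hst))
      (by
        filter_upwards [hpt] with t ht hst
        obtain ⟨-, h2, h3⟩ := ht (hs.trans hst)
        exact frequency_deriv_numerator_le hΛpos
          (ha_bound t (hs₀.trans (hs.trans hst)).le).1 h2 h3)
      (by
        filter_upwards [hpt] with t ht hst
        obtain ⟨-, h2, h3⟩ := ht (hs.trans hst)
        exact neg_le_energy_deriv (ha_bound t (hs₀.trans (hs.trans hst)).le).2
          (hD0 t (hs.trans hst).le) h2 h3)
      (by positivity)
    -- decay at the rate `|C| + 1` contradicts the exponential lower bound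
    have hl := hlim (|C| + 1) (by positivity)
    have hev := (hl.pow 2).eventually_lt_const (u := k) (by simpa using hk)
    have hev2 : ∀ᶠ t in atTop ⊓ ae (volume : Measure ℝ), s < t → U t = u t :=
      (show ∀ᵐ t, s < t → U t = u t by
        filter_upwards [hpt] with t ht hst using (ht (hs.trans hst)).1).filter_mono inf_le_right
    have hev3 : ∀ᶠ t in atTop ⊓ ae (volume : Measure ℝ), s < t :=
      (eventually_gt_atTop s).filter_mono inf_le_left
    have := neBot_atTop_inf_ae
    obtain ⟨t, h1, h2, h3⟩ := (hev.and (hev2.and hev3)).exists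
    have h4 := hlow t h3.le
    have hs0 : 0 < s := hs₀.trans hs
    simp only [h2 h3] at h4
    rw [mul_pow, normH1, Real.sq_sqrt (by positivity), ← Real.exp_nat_mul] at h1
    have h5 : k ≤ Real.exp (((2 : ℕ) : ℝ) * ((|C| + 1) * t)) * (‖u t‖ ^ 2 + ‖ux t‖ ^ 2) := by
      calc k = k * Real.exp 0 := by simp
        _ ≤ k * Real.exp (((2 : ℕ) : ℝ) * ((|C| + 1) * t) + -(C * (t - s))) := by
          gcongr
          have e1 : C * (t - s) ≤ |C| * t :=
            calc C * (t - s) ≤ |C| * (t - s) := by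
                  gcongr
                  exact le_abs_self C
              _ ≤ |C| * t := by gcongr; linarith
          have e2 : 0 ≤ |C| * t := by have := hs0.trans h3; positivity
          push_cast
          linarith [hs0.trans h3]
        _ = Real.exp (((2 : ℕ) : ℝ) * ((|C| + 1) * t)) * (k * Real.exp (-(C * (t - s)))) := by
          rw [Real.exp_add]; ring
        _ ≤ _ := by
          gcongr
          have : 0 ≤ ‖ux t‖ ^ 2 := by positivity
          linarith
    linarith
  filter_upwards [hc] with t ht hst
  rw [ht hst]
  exact hzero t hst
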